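/- **Theorem 4.4.** Let $X$ be a Hausdorff, locally compact and second countable topological space with a $\sigma$-finite and locally finite Borel measure $\mu$. *Partitions.* Let $(\mathcal A_n)_{n\ge 0}$ be a countable covering of $X$ by open sets with compact closure, and let $(\mathcal U_n)_{n\ge 0}$ be a countable basis for the topology of $X$. Let $\mathcal P_0$ consist of the sets $\mathcal A_n\setminus\overline{\mathcal A_0\cup\dots\cup\mathcal A_{n-1}}$ and $\partial\mathcal A_n\setminus\overline{\mathcal A_0\cup\dots\cup\mathcal A_{n-1}}$, $n\ge 0$, and put $$\mathcal P_{n+1}=\{\mathcal U_n\cap\mathcal A:\mathcal A\in\mathcal P_n\}\cup\{(X\setminus\overline{\mathcal U_n})\cap\mathcal A:\mathcal A\in\mathcal P_n\}\cup\{\partial\,\mathcal U_n\cap\mathcal A:\mathcal A\in\mathcal P_n\},\qquad n\ge 0.$$ Each $x\in X$ lies in exactly one element of $\mathcal P_n$, denoted $O_n(x)$. *Kernel.* Let $K:X\times X\to\mathbb C$ be a kernel in $L^2(X\times X,\mu\times\mu)$, let $\mathcal K:L^2(X,\mu)\to L^2(X,\mu)$ be the integral operator $\mathcal K(f)=\int_X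 K(\cdot,y)f(y)\,d\mu(y)$, and put $$E_n(K)(u,v)=\frac{1}{\mu(O_n(u))\,\mu(O_n(v))}\int_{O_n(u)}\int_{O_n(v)}K(x,y)\,d\mu(y)\,d\mu(x)$$ (with value $0$ if $\mu(O_n(u))\mu(O_n(v))=0$, which happens only when $u$ or $v$ belongs to a fixed $\mu$-null set). Assume that $K$ is $L^2(X,\mu)$-positive definite, that is, $\langle\mathcal K(f),f\rangle\ge 0$ for all $f\in L^2(X,\mu)$. Then $E_n(K)(x,x)\ge 0$ for all $x\in X$ and $n\ge 0$, so that $\int_X E_n(K)(x,x)\,d\mu(x)$ is defined in $[0,\infty]$. *Claim.* If $$\limsup_{n\to\infty}\int_X E_n(K)(x,x)\,d\mu(x)<\infty,$$ then $\mathcal K$ is trace-class, that is, $\sum_{f\in\mathfrak B}\langle(\mathcal K^*\mathcal K)^{1/2}f,f\rangle<\infty$ for every orthonormal basis $\mathfrak B$ of $L^2(X,\mu)$. -/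

import Mathlib

open MeasureTheory Filter Topology
open scoped ENNReal ComplexOrder

/-! ### Integral operators with square-integrable kernels -/

section IntegralOperator

universe u

variable {X : Type u} [MeasurableSpace X]

theorem memLp_two_section {μ : Measure X} [SFinite μ] {K : X × X → ℂ}
    (hK : MemLp K 2 (μ.prod μ)) : ∀ᵐ x ∂μ, MemLp (fun y => K (x, y)) 2 μ := by
  have h1 := (memLp_two_iff_integrable_sq_norm hK.1).1 hK
  filter_upwards [hK.1.prodMk_left, h1.prod_right_ae] with x hx1 hx2
  exact (memLp_two_iff_integrable_sq_norm hx1).2 hx2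

theorem eLpNorm_two_eq (μ : Measure X) (f : X → ℂ) :
    eLpNorm f 2 μ = (∫⁻ x, ‖f x‖ₑ ^ (2 : ℝ) ∂μ) ^ (1 / 2 : ℝ) := by
  rw [eLpNorm_eq_lintegral_rpow_enorm_toReal (by norm_num) (by norm_num)]
  norm_num

theorem aestronglyMeasurable_integral_kernel {μ : Measure X} [SFinite μ] {K : X × X → ℂ}
    (hK : MemLp K 2 (μ.prod μ)) {f : X → ℂ} (hf : MemLp f 2 μ) :
    AEStronglyMeasurable (fun x => ∫ y, K (x, y) * f y ∂μ) μ := by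
  have : AEStronglyMeasurable (fun p : X × X => K p * f p.2) (μ.prod μ) :=
    hK.1.mul (hf.1.comp_snd)
  exact this.integral_prod_right'

theorem eLpNorm_integral_kernel_le {μ : Measure X} [SFinite μ] {K : X × X → ℂ}
    (hK : MemLp K 2 (μ.prod μ)) {f : X → ℂ} (hf : MemLp f 2 μ) :
    eLpNorm (fun x => ∫ y, K (x, y) * f y ∂μ) 2 μ ≤
      eLpNorm K 2 (μ.prod μ) * eLpNorm f 2 μ := by
  have hpt : ∀ᵐ x ∂μ, ‖∫ y, K (x, y) * f y ∂μ‖ₑ ^ (2 : ℝ) ≤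
      (∫⁻ y, ‖K (x, y)‖ₑ ^ (2 : ℝ) ∂μ) * ∫⁻ y, ‖f y‖ₑ ^ (2 : ℝ) ∂μ := by
    filter_upwards [memLp_two_section hK] with x hx
    have h1 : ‖∫ y, K (x, y) * f y ∂μ‖ₑ ≤
        (∫⁻ y, ‖K (x, y)‖ₑ ^ (2 : ℝ) ∂μ) ^ (1 / 2 : ℝ) *
          (∫⁻ y, ‖f y‖ₑ ^ (2 : ℝ) ∂μ) ^ (1 / 2 : ℝ) := by
      refine (enorm_integral_le_lintegral_enorm _).trans ?_
      simp only [enorm_mul]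
      exact ENNReal.lintegral_mul_le_Lp_mul_Lq μ Real.HolderConjugate.two_two
        hx.1.enorm hf.1.enorm
    refine (ENNReal.rpow_le_rpow h1 (by norm_num)).trans ?_
    rw [ENNReal.mul_rpow_of_nonneg _ _ (by norm_num), ← ENNReal.rpow_mul, ← ENNReal.rpow_mul]
    norm_num
  have hm : AEMeasurable (fun p : X × X => ‖K p‖ₑ ^ (2 : ℝ)) (μ.prod μ) :=
    hK.1.enorm.pow_const _
  have hfin : (∫⁻ y, ‖f y‖ₑ ^ (2 : ℝ) ∂μ) ≠ ∞ := by
    have := hf.2.ne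
    rw [eLpNorm_two_eq] at this
    intro h
    exact this (by rw [h]; norm_num)
  rw [eLpNorm_two_eq, eLpNorm_two_eq μ f,
    eLpNorm_eq_lintegral_rpow_enorm_toReal (by norm_num) (by norm_num)]
  simp only [ENNReal.toReal_ofNat]
  rw [← ENNReal.mul_rpow_of_nonneg _ _ (by norm_num), lintegral_prod _ hm,
    ← lintegral_mul_const' _ _ hfin]
  exact ENNReal.rpow_le_rpow (lintegral_mono_ae hpt) (by norm_num)

theorem memLp_integral_kernel {μ : Measure X} [SFinite μ] {K : X × X → ℂ}
    (hK : MemLp K 2 (μ.prod μ)) {f : X → ℂ} (hf : MemLp f 2 μ) :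
    MemLp (fun x => ∫ y, K (x, y) * f y ∂μ) 2 μ :=
  ⟨aestronglyMeasurable_integral_kernel hK hf,
    (eLpNorm_integral_kernel_le hK hf).trans_lt (ENNReal.mul_lt_top hK.2 hf.2)⟩

/-- The integral operator on `L²(X, μ)` generated by a kernel `K ∈ L²(X × X, μ × μ)`: it sends
`f` to the class of `x ↦ ∫ K(x, y) f(y) dμ(y)`. -/
noncomputable def integralOperator {μ : Measure X} [SFinite μ] (K : X × X → ℂ)
    (hK : MemLp K 2 (μ.prod μ)) : Lp ℂ 2 μ →L[ℂ] Lp ℂ 2 μ :=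
  LinearMap.mkContinuous
    { toFun := fun f => (memLp_integral_kernel hK (Lp.memLp f)).toLp
        (fun x => ∫ y, K (x, y) * f y ∂μ)
      map_add' := by
        intro f g
        rw [← MemLp.toLp_add, MemLp.toLp_eq_toLp_iff]
        filter_upwards [memLp_two_section hK] with x hx
        have h1 : Integrable (fun y => K (x, y) * f y) μ := hx.integrable_mul (Lp.memLp f)
        have h2 : Integrable (fun y => K (x, y) * g y) μ := hx.integrable_mul (Lp.memLp g)
        rw [Pi.add_apply, ← integral_add h1 h2]
        refine integral_congr_ae ?_
        filter_upwards [Lp.coeFn_add f g] with y hy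
        rw [hy, Pi.add_apply, mul_add]
      map_smul' := by
        intro c f
        rw [RingHom.id_apply, ← MemLp.toLp_const_smul, MemLp.toLp_eq_toLp_iff]
        refine Eventually.of_forall fun x => ?_
        rw [Pi.smul_apply, smul_eq_mul, ← integral_const_mul]
        refine integral_congr_ae ?_
        filter_upwards [Lp.coeFn_smul c f] with y hy
        rw [hy, Pi.smul_apply, smul_eq_mul]
        ring }
    (eLpNorm K 2 (μ.prod μ)).toReal
    (by
      intro f
      simp only [LinearMap.coe_mk, AddHom.coe_mk, Lp.norm_toLp]
      rw [Lp.norm_def, ← ENNReal.toReal_mul]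
      exact ENNReal.toReal_mono (ENNReal.mul_ne_top hK.2.ne (Lp.memLp f).2.ne)
        (eLpNorm_integral_kernel_le hK (Lp.memLp f)))

/-- The defining formula of the integral operator. -/
theorem integralOperator_apply {μ : Measure X} [SFinite μ] (K : X × X → ℂ)
    (hK : MemLp K 2 (μ.prod μ)) (f : Lp ℂ 2 μ) :
    integralOperator K hK f =ᵐ[μ] fun x => ∫ y, K (x, y) * f y ∂μ :=
  (memLp_integral_kernel hK (Lp.memLp f)).coeFn_toLp

/-- A kernel `K ∈ L²(X × X, μ × μ)` is `L²(X, μ)`-positive definite if its integral operator `𝒦`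
satisfies `⟨𝒦 f, f⟩ ≥ 0` for all `f ∈ L²(X, μ)`. Mathlib's inner product is conjugate-linear in
the first argument, and `0 ≤ z` for `z : ℂ` says that `z` is real and nonnegative. -/
def IsL2PositiveDefinite {μ : Measure X} [SFinite μ] (K : X × X → ℂ)
    (hK : MemLp K 2 (μ.prod μ)) : Prop :=
  ∀ f : Lp ℂ 2 μ, 0 ≤ inner ℂ f (integralOperator K hK f)

end IntegralOperator

/-! ### Trace-class operators -/

/-- A bounded operator `T` on a complex Hilbert space is trace-class if
`∑ ⟨(T* T)^{1/2} f, f⟩ < ∞` over every orthonormal basis; `CFC.abs T` is the positive square root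
of `T* T`. All terms of the sum are nonnegative reals. -/
def IsTraceClass {H : Type*} [NormedAddCommGroup H] [InnerProductSpace ℂ H] [CompleteSpace H]
    (T : H →L[ℂ] H) : Prop :=
  ∀ (B : Set H) (b : HilbertBasis B ℂ H), (⇑b = ((↑) : B → H)) →
    Summable fun f : B => (inner ℂ (f : H) (CFC.abs T (f : H))).re

/-! ### The partitions and the averages -/

/-- The data from which the partitions are built: a countable covering of `X` by open sets with
compact closure, and a countable basis for the topology of `X` (both listed as sequences,
repetitions and empty sets being allowed). -/
structure PartitionData (X : Type*) [TopologicalSpace X] where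
  A : ℕ → Set X
  isOpen_A : ∀ n, IsOpen (A n)
  isCompact_closure_A : ∀ n, IsCompact (closure (A n))
  iUnion_A : ⋃ n, A n = Set.univ
  U : ℕ → Set X
  isTopologicalBasis_U : TopologicalSpace.IsTopologicalBasis (Set.range U)

namespace PartitionData

universe u

variable {X : Type u} [TopologicalSpace X]

/-- The partitions `𝒫₀, 𝒫₁, …`. The cells of `𝒫₀` are the sets `Aₙ \ closure (A₀ ∪ ⋯ ∪ Aₙ₋₁)` and
`∂Aₙ \ closure (A₀ ∪ ⋯ ∪ Aₙ₋₁)`; every cell of `𝒫ₙ` is cut into its intersections with `Uₙ`,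
`X \ closure Uₙ` and `∂Uₙ` to give the cells of `𝒫ₙ₊₁`. (The empty set may be listed as a cell.) -/
def partition (D : PartitionData X) : ℕ → Set (Set X)
  | 0 => {s | ∃ n, s = D.A n \ closure (⋃ m < n, D.A m)} ∪
      {s | ∃ n, s = frontier (D.A n) \ closure (⋃ m < n, D.A m)}
  | n + 1 => {s | ∃ t ∈ D.partition n, s = D.U n ∩ t} ∪
      {s | ∃ t ∈ D.partition n, s = (closure (D.U n))ᶜ ∩ t} ∪
      {s | ∃ t ∈ D.partition n, s = frontier (D.U n) ∩ t}

theorem isOpen_U (D : PartitionData X) (n : ℕ) : IsOpen (D.U n) :=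
  D.isTopologicalBasis_U.isOpen ⟨n, rfl⟩

theorem existsUnique_cell (D : PartitionData X) (n : ℕ) (x : X) :
    ∃! s, s ∈ D.partition n ∧ x ∈ s := by
  classical
  induction n with
  | zero =>
    have hcl : ∀ n, closure (⋃ m < n, D.A m) = ⋃ m < n, closure (D.A m) := fun n =>
      (Set.finite_lt_nat n).closure_biUnion _
    have hex : ∃ n, x ∈ closure (D.A n) := by
      have : x ∈ ⋃ n, D.A n := by rw [D.iUnion_A]; trivial
      obtain ⟨n, hn⟩ := Set.mem_iUnion.1 this
      exact ⟨n, subset_closure hn⟩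
    have hN : x ∉ closure (⋃ m < Nat.find hex, D.A m) := by
      rw [hcl]
      simp only [Set.mem_iUnion, not_exists]
      exact fun m hm => Nat.find_min hex hm
    have huniq : ∀ n, x ∈ closure (D.A n) → x ∉ closure (⋃ m < n, D.A m) →
        n = Nat.find hex := by
      intro n h1 h2
      rw [hcl] at h2
      simp only [Set.mem_iUnion, not_exists] at h2
      refine le_antisymm ?_ (Nat.find_min' hex h1)
      by_contra h
      exact h2 _ (not_le.1 h) (Nat.find_spec hex)
    by_cases hx : x ∈ D.A (Nat.find hex)
    · refine ⟨_, ⟨Or.inl ⟨Nat.find hex, rfl⟩, hx, hN⟩, ?_⟩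
      rintro s ⟨⟨n, rfl⟩ | ⟨n, rfl⟩, h1, h2⟩
      · rw [huniq n (subset_closure h1) h2]
      · have := huniq n (frontier_subset_closure h1) h2
        subst this
        rw [(D.isOpen_A _).frontier_eq] at h1
        exact absurd hx h1.2
    · have hx' : x ∈ frontier (D.A (Nat.find hex)) := by
        rw [(D.isOpen_A _).frontier_eq]
        exact ⟨Nat.find_spec hex, hx⟩
      refine ⟨_, ⟨Or.inr ⟨Nat.find hex, rfl⟩, hx', hN⟩, ?_⟩
      rintro s ⟨⟨n, rfl⟩ | ⟨n, rfl⟩, h1, h2⟩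
      · have := huniq n (subset_closure h1) h2
        subst this
        exact absurd h1 hx
      · rw [huniq n (frontier_subset_closure h1) h2]
  | succ n ih =>
    obtain ⟨t, ⟨ht, hxt⟩, hu⟩ := ih
    have hfr := (D.isOpen_U n).frontier_eq
    have hsub : D.U n ⊆ closure (D.U n) := subset_closure
    by_cases h1 : x ∈ D.U n
    · refine ⟨D.U n ∩ t, ⟨Or.inl (Or.inl ⟨t, ht, rfl⟩), h1, hxt⟩, ?_⟩
      rintro s ⟨(⟨t', ht', rfl⟩ | ⟨t', ht', rfl⟩) | ⟨t', ht', rfl⟩, h2, h3⟩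
      · rw [hu t' ⟨ht', h3⟩]
      · exact absurd (hsub h1) h2
      · rw [hfr] at h2
        exact absurd h1 h2.2
    · by_cases h4 : x ∈ closure (D.U n)
      · refine ⟨frontier (D.U n) ∩ t, ⟨Or.inr ⟨t, ht, rfl⟩, hfr ▸ ⟨h4, h1⟩, hxt⟩, ?_⟩
        rintro s ⟨(⟨t', ht', rfl⟩ | ⟨t', ht', rfl⟩) | ⟨t', ht', rfl⟩, h2, h3⟩
        · exact absurd h2 h1
        · exact absurd h4 h2
        · rw [hu t' ⟨ht', h3⟩]
      · refine ⟨(closure (D.U n))ᶜ ∩ t, ⟨Or.inl (Or.inr ⟨t, ht, rfl⟩), h4, hxt⟩, ?_⟩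
        rintro s ⟨(⟨t', ht', rfl⟩ | ⟨t', ht', rfl⟩) | ⟨t', ht', rfl⟩, h2, h3⟩
        · exact absurd h2 h1
        · rw [hu t' ⟨ht', h3⟩]
        · exact absurd (frontier_subset_closure h2) h4

/-- `Oₙ(x)`, the unique cell of the `n`-th partition that contains `x`. -/
noncomputable def cell (D : PartitionData X) (n : ℕ) (x : X) : Set X :=
  (D.existsUnique_cell n x).choose

theorem cell_mem (D : PartitionData X) (n : ℕ) (x : X) : D.cell n x ∈ D.partition n :=
  (D.existsUnique_cell n x).choose_spec.1.1

theorem mem_cell (D : PartitionData X) (n : ℕ) (x : X) : x ∈ D.cell n x :=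
  (D.existsUnique_cell n x).choose_spec.1.2

/-- The average `Eₙ(K)(u, v)` of the kernel `K` over the cell `Oₙ(u) × Oₙ(v)` of the product
partition `𝒫ₙ × 𝒫ₙ`. It is set to `0` if one of the two cells is a null set, which happens only
for `u` or `v` in a fixed set of measure zero. -/
noncomputable def kernelAverage [MeasurableSpace X] (D : PartitionData X) (μ : Measure X) (n : ℕ)
    (K : X × X → ℂ) (u v : X) : ℂ :=
  ((μ.real (D.cell n u) * μ.real (D.cell n v) : ℝ) : ℂ)⁻¹ *
    ∫ x in D.cell n u, ∫ y in D.cell n v, K (x, y) ∂μ ∂μ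

end PartitionData

/-! ### Hilbert–Schmidt sums in Hilbert spaces -/

section HilbertSchmidt

variable {H : Type*} [NormedAddCommGroup H] [InnerProductSpace ℂ H]

/-! Let `T` be the integral operator, `S` its positive square root and `V n` the closed span of the
normalised indicators of the cells of the `n`-th partition. The diagonal matrix coefficient of `T`
at the indicator of a cell `s` is the integral of `Eₙ(K)(x, x)` over `s`, so the hypothesis bounds
`∑ ‖S (v n i)‖²`, the squared Hilbert–Schmidt norm of `S` on `V n`, for all large `n`.

The partitions refine each other and their cells generate the Borel sets, so `V n` increases and has
dense union, and the projections onto `V n` converge strongly to the identity. The bound then passes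
to `∑ ‖S f‖² = ∑ ⟨T f, f⟩` over any orthonormal family, and `T = |T|` by positivity. No pointwise
convergence of the averages is needed.

The Hilbert space half is `tsum_enorm_apply_sq_le_of_eventually`; the measure-theoretic half is
`orthogonal_iSup_closure_span_cellVector` and `tsum_inner_cellVector_le`. -/

theorem Orthonormal.tsum_enorm_inner_sq_le {ι : Type*} {v : ι → H} (hv : Orthonormal ℂ v) (x : H) :
    ∑' i, ‖inner ℂ (v i) x‖ₑ ^ 2 ≤ ‖x‖ₑ ^ 2 := by
  refine ENNReal.summable.tsum_le_of_sum_le fun s => ?_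
  have h := ENNReal.ofReal_le_ofReal (hv.sum_inner_products_le x (s := s))
  rw [ENNReal.ofReal_sum_of_nonneg fun _ _ => by positivity] at h
  simpa only [ENNReal.ofReal_pow (norm_nonneg _), ofReal_norm] using h

theorem HilbertBasis.tsum_enorm_inner_sq {ι : Type*} (b : HilbertBasis ι ℂ H) (x : H) :
    ∑' i, ‖inner ℂ (b i) x‖ₑ ^ 2 = ‖x‖ₑ ^ 2 := by
  have h := b.hasSum_inner_mul_inner x x
  have h1 : HasSum (fun i => ‖inner ℂ (b i) x‖ ^ 2) (‖x‖ ^ 2) := by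
    have h2 := Complex.hasSum_re h
    rw [inner_self_eq_norm_sq_to_K] at h2
    convert h2 using 1
    · ext i
      rw [← inner_conj_symm x (b i), ← Complex.normSq_eq_conj_mul_self, Complex.ofReal_re,
        Complex.normSq_eq_norm_sq]
    · norm_cast
  have h3 := ENNReal.ofReal_tsum_of_nonneg (fun i => by positivity) h1.summable
  rw [h1.tsum_eq] at h3
  simpa only [ENNReal.ofReal_pow (norm_nonneg _), ofReal_norm] using h3.symm

variable [CompleteSpace H]

theorem Orthonormal.enorm_starProjection_sq_le {ι : Type*} {v : ι → H} (hv : Orthonormal ℂ v)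
    (x : H) :
    ‖(Submodule.span ℂ (Set.range v)).topologicalClosure.starProjection x‖ₑ ^ 2 ≤
      ∑' i, ‖inner ℂ (v i) x‖ₑ ^ 2 := by
  set V := (Submodule.span ℂ (Set.range v)).topologicalClosure
  have hvV : ∀ i, v i ∈ V := fun i =>
    Submodule.le_topologicalClosure _ (Submodule.subset_span ⟨i, rfl⟩)
  obtain ⟨w, b, hw, hb⟩ := hv.toSubtypeRange.exists_hilbertBasis_extension
  let g : ι → w := fun i => ⟨v i, hw ⟨i, rfl⟩⟩
  have hg : Function.Injective g := fun i j hij =>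
    hv.linearIndependent.injective (congrArg Subtype.val hij)
  rw [← b.tsum_enorm_inner_sq, ← hg.tsum_eq]
  · refine le_of_eq (tsum_congr fun i => ?_)
    rw [hb, ← Submodule.inner_starProjection_left_eq_right,
      Submodule.starProjection_eq_self_iff.2 (hvV i)]
  -- Basis vectors outside the family `v` are orthogonal to `V`, so Parseval for the projection only
  -- sees `v`.
  · intro u hu
    by_contra hur
    refine hu ?_
    have horth : V ≤ (Submodule.span ℂ {b u})ᗮ := by
      refine Submodule.topologicalClosure_minimal _ (Submodule.span_le.2 ?_)
        (Submodule.isClosed_orthogonal _)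
      rintro _ ⟨i, rfl⟩
      rw [SetLike.mem_coe, Submodule.mem_orthogonal_singleton_iff_inner_right]
      have h1 : b (g i) = v i := by rw [hb]
      rw [← h1]
      exact b.orthonormal.2 fun h => hur ⟨i, h.symm⟩
    have := (Submodule.mem_orthogonal_singleton_iff_inner_right (𝕜 := ℂ)).1
      (horth (Submodule.starProjection_apply_mem V x))
    change ‖inner ℂ (b u) (V.starProjection x)‖ₑ ^ 2 = 0
    simp [this]

/-- With `P` the projection, expand in an auxiliary basis `b` and exchange the sums: the left side
becomes `∑ |⟨f j, P S (b k)⟩|²`, which Bessel bounds by `∑ ‖P S (b k)‖²`, and this is controlled by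
the coefficients along `v`. -/
theorem tsum_enorm_apply_starProjection_sq_le {ι κ : Type*} {S : H →L[ℂ] H}
    (hS : (S : H →ₗ[ℂ] H).IsSymmetric) {v : ι → H} (hv : Orthonormal ℂ v) {f : κ → H}
    (hf : Orthonormal ℂ f) :
    ∑' j, ‖S ((Submodule.span ℂ (Set.range v)).topologicalClosure.starProjection (f j))‖ₑ ^ 2 ≤
      ∑' i, ‖S (v i)‖ₑ ^ 2 := by
  set V := (Submodule.span ℂ (Set.range v)).topologicalClosure
  obtain ⟨w, b, -⟩ := exists_hilbertBasis ℂ H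
  have hsymm : ∀ x y, inner ℂ (S x) y = inner ℂ x (S y) := hS
  have hcomm : ∀ x y : H, ‖inner ℂ x y‖ₑ = ‖inner ℂ y x‖ₑ := fun x y => by
    rw [← ofReal_norm, ← ofReal_norm, norm_inner_symm]
  calc ∑' j, ‖S (V.starProjection (f j))‖ₑ ^ 2
      = ∑' j, ∑' k, ‖inner ℂ (f j) (V.starProjection (S (b k)))‖ₑ ^ 2 := by
        refine tsum_congr fun j => ?_
        rw [← b.tsum_enorm_inner_sq]
        refine tsum_congr fun k => ?_
        rw [← hsymm, ← Submodule.inner_starProjection_left_eq_right, hcomm]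
    _ = ∑' k, ∑' j, ‖inner ℂ (f j) (V.starProjection (S (b k)))‖ₑ ^ 2 := ENNReal.tsum_comm
    _ ≤ ∑' k, ∑' i, ‖inner ℂ (v i) (S (b k))‖ₑ ^ 2 := ENNReal.tsum_le_tsum fun k =>
        (hf.tsum_enorm_inner_sq_le _).trans (hv.enorm_starProjection_sq_le _)
    _ = ∑' i, ∑' k, ‖inner ℂ (v i) (S (b k))‖ₑ ^ 2 := ENNReal.tsum_comm
    _ = ∑' i, ‖S (v i)‖ₑ ^ 2 := by
        refine tsum_congr fun i => ?_
        rw [← b.tsum_enorm_inner_sq]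
        refine tsum_congr fun k => ?_
        rw [← hsymm, hcomm]

/-- Strong convergence of the projections suffices because each finite partial sum depends
continuously on finitely many vectors. -/
theorem tsum_enorm_apply_sq_le_of_eventually {κ : Type*} {ι : ℕ → Type*} {S : H →L[ℂ] H}
    (hS : (S : H →ₗ[ℂ] H).IsSymmetric) {v : ∀ n, ι n → H} (hv : ∀ n, Orthonormal ℂ (v n))
    (hmono : Monotone fun n => (Submodule.span ℂ (Set.range (v n))).topologicalClosure)
    (hdense : (⨆ n, (Submodule.span ℂ (Set.range (v n))).topologicalClosure)ᗮ = ⊥)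
    {M : ℝ≥0∞} (hM : ∀ᶠ n in atTop, ∑' i, ‖S (v n i)‖ₑ ^ 2 ≤ M) {f : κ → H}
    (hf : Orthonormal ℂ f) :
    ∑' j, ‖S (f j)‖ₑ ^ 2 ≤ M := by
  refine ENNReal.summable.tsum_le_of_sum_le fun s => ?_
  have hlim : ∀ x, Tendsto (fun n =>
      (Submodule.span ℂ (Set.range (v n))).topologicalClosure.starProjection x) atTop (𝓝 x) :=
    fun x => Submodule.starProjection_tendsto_self _ hmono x
      ((Submodule.topologicalClosure_eq_top_iff).2 hdense).ge
  have hsum : Tendsto (fun n => ∑ j ∈ s,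
      ‖S ((Submodule.span ℂ (Set.range (v n))).topologicalClosure.starProjection (f j))‖ₑ ^ 2)
      atTop (𝓝 (∑ j ∈ s, ‖S (f j)‖ₑ ^ 2)) := by
    refine tendsto_finsetSum s fun j _ => ?_
    exact ((ENNReal.continuous_pow 2).comp
      (continuous_enorm.comp S.continuous)).continuousAt.tendsto.comp (hlim (f j))
  refine le_of_tendsto hsum ?_
  filter_upwards [hM] with n hn
  exact (ENNReal.sum_le_tsum s).trans
    ((tsum_enorm_apply_starProjection_sq_le hS (hv n) hf).trans hn)

theorem enorm_sqrt_apply_sq {T : H →L[ℂ] H} (hT : 0 ≤ T) (x : H) :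
    ‖CFC.sqrt T x‖ₑ ^ 2 = ENNReal.ofReal (inner ℂ x (T x)).re := by
  have hsymm : ((CFC.sqrt T : H →L[ℂ] H) : H →ₗ[ℂ] H).IsSymmetric :=
    ((ContinuousLinearMap.nonneg_iff_isPositive _).1 (CFC.sqrt_nonneg T)).isSymmetric
  have h : T x = CFC.sqrt T (CFC.sqrt T x) := by
    conv_lhs => rw [← CFC.sqrt_mul_sqrt_self T hT]
    rfl
  have h2 : inner ℂ x (CFC.sqrt T (CFC.sqrt T x)) =
      inner ℂ (CFC.sqrt T x) (CFC.sqrt T x) := (hsymm x _).symm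
  rw [h, h2, inner_self_eq_norm_sq_to_K, ← ofReal_norm, ← ENNReal.ofReal_pow (norm_nonneg _)]
  norm_cast

/-- A positive operator is trace-class as soon as its traces along an exhausting sequence of
orthonormal families stay bounded. -/
theorem isTraceClass_of_eventually {ι : ℕ → Type*} {T : H →L[ℂ] H} (hT : 0 ≤ T)
    {v : ∀ n, ι n → H} (hv : ∀ n, Orthonormal ℂ (v n))
    (hmono : Monotone fun n => (Submodule.span ℂ (Set.range (v n))).topologicalClosure)
    (hdense : (⨆ n, (Submodule.span ℂ (Set.range (v n))).topologicalClosure)ᗮ = ⊥)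
    {M : ℝ≥0∞} (hMtop : M ≠ ∞)
    (hM : ∀ᶠ n in atTop, ∑' i, ENNReal.ofReal (inner ℂ (v n i) (T (v n i))).re ≤ M) :
    IsTraceClass T := by
  intro B b hb
  have hsymm : ((CFC.sqrt T : H →L[ℂ] H) : H →ₗ[ℂ] H).IsSymmetric :=
    ((ContinuousLinearMap.nonneg_iff_isPositive _).1 (CFC.sqrt_nonneg T)).isSymmetric
  simp only [← enorm_sqrt_apply_sq hT] at hM
  have hf : Orthonormal ℂ ((↑) : B → H) := hb ▸ b.orthonormal
  have h := tsum_enorm_apply_sq_le_of_eventually hsymm hv hmono hdense hM hf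
  simp only [enorm_sqrt_apply_sq hT] at h
  rw [CFC.abs_of_nonneg T hT]
  refine (ENNReal.summable_toReal (ne_top_of_le_ne_top hMtop h)).congr fun x => ?_
  exact ENNReal.toReal_ofReal
    (((ContinuousLinearMap.nonneg_iff_isPositive T).1 hT).re_inner_nonneg_right _)

end HilbertSchmidt

theorem Complex.inv_ofReal_sqrt_mul_self {r : ℝ} (hr : 0 ≤ r) :
    ((Real.sqrt r : ℝ) : ℂ)⁻¹ * ((Real.sqrt r : ℝ) : ℂ)⁻¹ = (r : ℂ)⁻¹ := by
  rw [← mul_inv, ← Complex.ofReal_mul, Real.mul_self_sqrt hr]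

/-! ### The cells of the partitions -/

namespace PartitionData

universe u

variable {X : Type u} [TopologicalSpace X] (D : PartitionData X)

theorem eq_of_mem_of_mem {n : ℕ} {s t : Set X} (hs : s ∈ D.partition n) (ht : t ∈ D.partition n)
    {x : X} (hxs : x ∈ s) (hxt : x ∈ t) : s = t :=
  (D.existsUnique_cell n x).unique ⟨hs, hxs⟩ ⟨ht, hxt⟩

theorem cell_eq {n : ℕ} {s : Set X} (hs : s ∈ D.partition n) {x : X} (hx : x ∈ s) :
    D.cell n x = s :=
  D.eq_of_mem_of_mem (D.cell_mem n x) hs (D.mem_cell n x) hx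

theorem disjoint_of_ne {n : ℕ} {s t : Set X} (hs : s ∈ D.partition n) (ht : t ∈ D.partition n)
    (hst : s ≠ t) : Disjoint s t :=
  Set.disjoint_left.2 fun _ hxs hxt => hst (D.eq_of_mem_of_mem hs ht hxs hxt)

theorem countable_partition (n : ℕ) : (D.partition n).Countable := by
  induction n with
  | zero =>
    refine Set.Countable.union ?_ ?_
    · exact (Set.countable_range fun n => D.A n \ closure (⋃ m < n, D.A m)).mono
        (by rintro _ ⟨n, rfl⟩; exact ⟨n, rfl⟩)
    · exact (Set.countable_range fun n => frontier (D.A n) \ closure (⋃ m < n, D.A m)).mono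
        (by rintro _ ⟨n, rfl⟩; exact ⟨n, rfl⟩)
  | succ n ih =>
    have h : ∀ B : Set X, {s | ∃ t ∈ D.partition n, s = B ∩ t}.Countable := fun B =>
      (ih.image fun t => B ∩ t).mono (by rintro _ ⟨t, ht, rfl⟩; exact ⟨t, ht, rfl⟩)
    exact ((h _).union (h _)).union (h _)

theorem exists_superset_of_mem_succ {n : ℕ} {s : Set X} (hs : s ∈ D.partition (n + 1)) :
    ∃ t ∈ D.partition n, s ⊆ t := by
  rcases hs with (⟨t, ht, rfl⟩ | ⟨t, ht, rfl⟩) | ⟨t, ht, rfl⟩ <;>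
    exact ⟨t, ht, Set.inter_subset_right⟩

theorem exists_superset {m n : ℕ} (hmn : m ≤ n) {s : Set X} (hs : s ∈ D.partition n) :
    ∃ t ∈ D.partition m, s ⊆ t := by
  induction n, hmn using Nat.le_induction generalizing s with
  | base => exact ⟨s, hs, subset_rfl⟩
  | succ n _ ih =>
    obtain ⟨t, ht, hst⟩ := D.exists_superset_of_mem_succ hs
    obtain ⟨r, hr, htr⟩ := ih ht
    exact ⟨r, hr, hst.trans htr⟩

theorem subset_of_mem_of_mem {m n : ℕ} (hmn : m ≤ n) {s t : Set X} (hs : s ∈ D.partition n)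
    (ht : t ∈ D.partition m) {x : X} (hxs : x ∈ s) (hxt : x ∈ t) : s ⊆ t := by
  obtain ⟨r, hr, hsr⟩ := D.exists_superset hmn hs
  rwa [D.eq_of_mem_of_mem ht hr hxt (hsr hxs)]

/-- Two cells, even of different levels, are either disjoint or nested. -/
theorem isPiSystem_iUnion_partition : IsPiSystem (⋃ n, D.partition n) := by
  intro s hs t ht ⟨x, hxs, hxt⟩
  obtain ⟨m, hs'⟩ := Set.mem_iUnion.1 hs
  obtain ⟨n, ht'⟩ := Set.mem_iUnion.1 ht
  rcases le_total m n with h | h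
  · rwa [Set.inter_eq_self_of_subset_right (D.subset_of_mem_of_mem h ht' hs' hxt hxs)]
  · rwa [Set.inter_eq_self_of_subset_left (D.subset_of_mem_of_mem h hs' ht' hxs hxt)]

/-- `U n` is the set used to cut level `n`, so it is resolved by the cells of level `n + 1`. As
these are countably many, the cells generate the Borel σ-algebra. -/
theorem U_eq_sUnion (n : ℕ) : D.U n = ⋃₀ {t | t ∈ D.partition (n + 1) ∧ t ⊆ D.U n} := by
  refine Set.Subset.antisymm (fun x hx => ?_) (Set.sUnion_subset fun t ht => ht.2)
  exact ⟨D.U n ∩ D.cell n x, ⟨Or.inl (Or.inl ⟨_, D.cell_mem n x, rfl⟩), Set.inter_subset_left⟩,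
    hx, D.mem_cell n x⟩

theorem exists_subset_closure_A {s : Set X} (hs : s ∈ D.partition 0) :
    ∃ n, s ⊆ closure (D.A n) := by
  rcases hs with ⟨n, rfl⟩ | ⟨n, rfl⟩
  · exact ⟨n, Set.sdiff_subset.trans subset_closure⟩
  · exact ⟨n, Set.sdiff_subset.trans frontier_subset_closure⟩

theorem measure_ne_top [MeasurableSpace X] (μ : Measure X) [IsLocallyFiniteMeasure μ] {n : ℕ}
    {s : Set X} (hs : s ∈ D.partition n) : μ s ≠ ∞ := by
  obtain ⟨t, ht, hst⟩ := D.exists_superset (Nat.zero_le n) hs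
  obtain ⟨m, hm⟩ := D.exists_subset_closure_A ht
  exact measure_ne_top_of_subset (hst.trans hm) (D.isCompact_closure_A m).measure_lt_top.ne

/-- The cells of the `n`-th partition of positive measure. -/
abbrev PosCell [MeasurableSpace X] (μ : Measure X) (n : ℕ) : Type u := {s : Set X // s ∈ D.partition n ∧ μ s ≠ 0}

theorem measureReal_pos [MeasurableSpace X] {μ : Measure X}
    [IsLocallyFiniteMeasure μ] {n : ℕ} (s : D.PosCell μ n) : 0 < μ.real s.1 :=
  ENNReal.toReal_pos s.2.2 (D.measure_ne_top μ s.2.1)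

/-- Splitting the integral over a cell into the integrals over its three pieces. -/
theorem setIntegral_eq_zero_of_succ [MeasurableSpace X] [OpensMeasurableSpace X] {μ : Measure X} {n : ℕ} {f : X → ℂ} {s : Set X}
    (hs : s ∈ D.partition n) (hf : IntegrableOn f s μ)
    (h : ∀ t ∈ D.partition (n + 1), ∫ x in t, f x ∂μ = 0) : ∫ x in s, f x ∂μ = 0 := by
  have h1 := h _ (Or.inl (Or.inl ⟨s, hs, rfl⟩))
  have h2 := h _ (Or.inl (Or.inr ⟨s, hs, rfl⟩))
  have h3 := h _ (Or.inr ⟨s, hs, rfl⟩)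
  -- Cut by `U n` first, then cut the remainder by its closure; openness of `U n` identifies the
  -- middle piece with the frontier.
  have hfr : s \ D.U n ∩ closure (D.U n) = frontier (D.U n) ∩ s := by
    rw [(D.isOpen_U n).frontier_eq]
    ext x
    simp only [Set.mem_inter_iff, Set.mem_sdiff]
    tauto
  have hcl : (s \ D.U n) \ closure (D.U n) = (closure (D.U n))ᶜ ∩ s := by
    ext x
    have : x ∈ D.U n → x ∈ closure (D.U n) := fun hx => subset_closure hx
    simp only [Set.mem_inter_iff, Set.mem_sdiff, Set.mem_compl_iff]
    tauto
  rw [← integral_inter_add_sdiff (D.isOpen_U n).measurableSet hf, Set.inter_comm, h1,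
    ← integral_inter_add_sdiff (s := s \ D.U n) isClosed_closure.measurableSet
      (hf.mono_set Set.sdiff_subset), hfr, hcl, h2, h3]
  simp

variable [MeasurableSpace X] [BorelSpace X]

theorem measurableSet_of_mem {n : ℕ} {s : Set X} (hs : s ∈ D.partition n) : MeasurableSet s := by
  induction n generalizing s with
  | zero =>
    rcases hs with ⟨n, rfl⟩ | ⟨n, rfl⟩
    · exact (D.isOpen_A n).measurableSet.diff isClosed_closure.measurableSet
    · exact isClosed_frontier.measurableSet.diff isClosed_closure.measurableSet
  | succ n ih =>
    rcases hs with (⟨t, ht, rfl⟩ | ⟨t, ht, rfl⟩) | ⟨t, ht, rfl⟩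
    · exact (D.isOpen_U n).measurableSet.inter (ih ht)
    · exact isClosed_closure.measurableSet.compl.inter (ih ht)
    · exact isClosed_frontier.measurableSet.inter (ih ht)

theorem generateFrom_iUnion_partition [SecondCountableTopology X] :
    ‹MeasurableSpace X› = MeasurableSpace.generateFrom (⋃ n, D.partition n) := by
  refine le_antisymm ?_ (MeasurableSpace.generateFrom_le fun s hs => ?_)
  · rw [BorelSpace.measurable_eq (α := X), D.isTopologicalBasis_U.borel_eq_generateFrom]
    refine MeasurableSpace.generateFrom_le ?_
    rintro _ ⟨n, rfl⟩
    rw [D.U_eq_sUnion n]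
    refine MeasurableSet.sUnion ((D.countable_partition (n + 1)).mono fun t ht => ht.1)
      fun t ht => MeasurableSpace.measurableSet_generateFrom (Set.mem_iUnion.2 ⟨_, ht.1⟩)
  · obtain ⟨n, hn⟩ := Set.mem_iUnion.1 hs
    exact D.measurableSet_of_mem hn

theorem ae_eq_zero_of_forall_setIntegral_eq_zero [SecondCountableTopology X] {μ : Measure X}
    {f : X → ℂ} (hf : ∀ s ∈ D.partition 0, IntegrableOn f s μ)
    (h : ∀ n, ∀ s ∈ D.partition n, ∫ x in s, f x ∂μ = 0) : f =ᵐ[μ] 0 := by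
  -- `f` need not be integrable on all of `X`, so the π-λ argument runs inside one cell of level `0`
  -- at a time.
  have key : ∀ s ∈ D.partition 0, ∀ t, MeasurableSet t → ∫ x in t, f x ∂(μ.restrict s) = 0 := by
    intro s hs t ht
    have hfs : Integrable f (μ.restrict s) := hf s hs
    induction t, ht using MeasurableSpace.induction_on_inter D.generateFrom_iUnion_partition
      D.isPiSystem_iUnion_partition with
    | empty => simp
    | basic t ht =>
      obtain ⟨n, hn⟩ := Set.mem_iUnion.1 ht
      rw [Measure.restrict_restrict (D.measurableSet_of_mem hn)]
      rcases (t ∩ s).eq_empty_or_nonempty with he | ⟨x, hxt, hxs⟩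
      · simp [he]
      · rw [Set.inter_eq_self_of_subset_left
          (D.subset_of_mem_of_mem (Nat.zero_le n) hn hs hxt hxs)]
        exact h n t hn
    | compl t ht ih =>
      rw [setIntegral_compl ht hfs, ih, h 0 s hs, sub_zero]
    | iUnion t hd ht ih =>
      rw [integral_iUnion ht hd hfs.integrableOn]
      simp [ih]
  have hcover : ⋃₀ D.partition 0 = Set.univ :=
    Set.eq_univ_of_forall fun x => ⟨_, D.cell_mem 0 x, D.mem_cell 0 x⟩
  rw [← Measure.restrict_univ (μ := μ), ← hcover, Set.sUnion_eq_biUnion, Filter.EventuallyEq,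
    ae_restrict_biUnion_iff _ (D.countable_partition 0)]
  exact fun s hs => Integrable.ae_eq_zero_of_forall_setIntegral_eq_zero (hf s hs)
    fun t ht _ => key s hs t ht

/-! ### The normalised indicators of the cells -/

variable (μ : Measure X) [IsLocallyFiniteMeasure μ]

/-- The indicator of a cell of positive measure, normalised in `L²`. -/
noncomputable def cellVector (n : ℕ) (s : D.PosCell μ n) : Lp ℂ 2 μ :=
  ((Real.sqrt (μ.real s.1) : ℝ) : ℂ)⁻¹ •
    indicatorConstLp 2 (D.measurableSet_of_mem s.2.1) (D.measure_ne_top μ s.2.1) (1 : ℂ)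

variable {μ}

theorem inner_cellVector {n : ℕ} (s : D.PosCell μ n) (f : Lp ℂ 2 μ) :
    inner ℂ (D.cellVector μ n s) f =
      ((Real.sqrt (μ.real s.1) : ℝ) : ℂ)⁻¹ * ∫ x in s.1, f x ∂μ := by
  rw [cellVector, inner_smul_left, L2.inner_indicatorConstLp_one, map_inv₀, Complex.conj_ofReal]

theorem orthonormal_cellVector (n : ℕ) : Orthonormal ℂ (D.cellVector μ n) := by
  classical
  rw [orthonormal_iff_ite]
  intro s t
  rw [cellVector, cellVector, inner_smul_left, inner_smul_right,
    L2.inner_indicatorConstLp_one_indicatorConstLp_one _ _ (D.measure_ne_top μ s.2.1)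
      (D.measure_ne_top μ t.2.1), map_inv₀, Complex.conj_ofReal]
  split_ifs with h
  · subst h
    rw [Set.inter_self, ← mul_assoc, Complex.inv_ofReal_sqrt_mul_self measureReal_nonneg]
    exact inv_mul_cancel₀ (Complex.ofReal_ne_zero.2 (D.measureReal_pos s).ne')
  · rw [(D.disjoint_of_ne s.2.1 t.2.1 fun hst => h (Subtype.ext hst)).inter_eq]
    simp

/-- Null cells carry no vector, but the integral over them vanishes anyway. -/
theorem mem_orthogonal_cellVector_iff {n : ℕ} {f : Lp ℂ 2 μ} :
    f ∈ (Submodule.span ℂ (Set.range (D.cellVector μ n))).topologicalClosureᗮ ↔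
      ∀ s ∈ D.partition n, ∫ x in s, f x ∂μ = 0 := by
  rw [Submodule.orthogonal_closure]
  constructor
  · intro hf s hs
    by_cases h0 : μ s = 0
    · exact setIntegral_measure_zero _ h0
    · have h := (Submodule.mem_orthogonal _ _).1 hf _
        (Submodule.subset_span ⟨(⟨s, hs, h0⟩ : D.PosCell μ n), rfl⟩)
      rw [inner_cellVector] at h
      refine (mul_eq_zero.1 h).resolve_left (inv_ne_zero (Complex.ofReal_ne_zero.2 ?_))
      exact (Real.sqrt_pos.2 (D.measureReal_pos (⟨s, hs, h0⟩ : D.PosCell μ n))).ne'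
  · intro h
    have : Submodule.span ℂ (Set.range (D.cellVector μ n)) ≤ (Submodule.span ℂ {f})ᗮ := by
      refine Submodule.span_le.2 ?_
      rintro _ ⟨s, rfl⟩
      rw [SetLike.mem_coe, Submodule.mem_orthogonal_singleton_iff_inner_left, inner_cellVector,
        h _ s.2.1, mul_zero]
    exact (Submodule.mem_orthogonal _ _).2 fun g hg =>
      Submodule.mem_orthogonal_singleton_iff_inner_left.1 (this hg)

theorem monotone_closure_span_cellVector : Monotone fun n =>
    (Submodule.span ℂ (Set.range (D.cellVector μ n))).topologicalClosure := by
  refine monotone_nat_of_le_succ fun n => ?_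
  -- Inclusion is checked on orthogonal complements, where it says that zero integrals over the
  -- pieces give zero integral over the cell; closed subspaces are recovered by taking complements
  -- again.
  have h : (Submodule.span ℂ (Set.range (D.cellVector μ (n + 1)))).topologicalClosureᗮ ≤
      (Submodule.span ℂ (Set.range (D.cellVector μ n))).topologicalClosureᗮ := by
    intro f hf
    rw [mem_orthogonal_cellVector_iff] at hf ⊢
    exact fun s hs => D.setIntegral_eq_zero_of_succ hs
      (integrableOn_Lp_of_measure_ne_top f (by norm_num) (D.measure_ne_top μ hs)) hf
  have h2 := Submodule.orthogonal_le h
  rwa [Submodule.orthogonal_orthogonal, Submodule.orthogonal_orthogonal] at h2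

theorem orthogonal_iSup_closure_span_cellVector [SecondCountableTopology X] :
    (⨆ n, (Submodule.span ℂ (Set.range (D.cellVector μ n))).topologicalClosure)ᗮ = ⊥ := by
  rw [Submodule.eq_bot_iff]
  intro f hf
  refine Lp.eq_zero_iff_ae_eq_zero.2 (D.ae_eq_zero_of_forall_setIntegral_eq_zero
    (fun s hs => integrableOn_Lp_of_measure_ne_top f (by norm_num) (D.measure_ne_top μ hs))
    fun n => ?_)
  exact D.mem_orthogonal_cellVector_iff.1 (Submodule.orthogonal_le
    (le_iSup (fun n => (Submodule.span ℂ (Set.range (D.cellVector μ n))).topologicalClosure) n) hf)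

/-! ### Traces along the cells -/

variable [SigmaFinite μ] {K : X × X → ℂ} (hK : MemLp K 2 (μ.prod μ))

theorem inner_cellVector_integralOperator {n : ℕ} (s : D.PosCell μ n) :
    inner ℂ (D.cellVector μ n s) (integralOperator K hK (D.cellVector μ n s)) =
      ((μ.real s.1 : ℝ) : ℂ)⁻¹ * ∫ x in s.1, ∫ y in s.1, K (x, y) ∂μ ∂μ := by
  have hs := D.measurableSet_of_mem s.2.1
  conv_lhs => rw [cellVector, map_smul, inner_smul_left, inner_smul_right]
  rw [L2.inner_indicatorConstLp_one, map_inv₀, Complex.conj_ofReal, ← mul_assoc,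
    Complex.inv_ofReal_sqrt_mul_self measureReal_nonneg]
  congr 1
  refine integral_congr_ae ?_
  filter_upwards [ae_restrict_of_ae (integralOperator_apply K hK (indicatorConstLp 2 hs
    (D.measure_ne_top μ s.2.1) (1 : ℂ)))] with x hx
  rw [hx, ← integral_indicator hs]
  refine integral_congr_ae ?_
  filter_upwards [indicatorConstLp_coeFn (p := 2) (hs := hs)
    (hμs := D.measure_ne_top μ s.2.1) (c := (1 : ℂ))] with y hy
  rw [hy]
  by_cases hys : y ∈ s.1 <;> simp [hys]

/-- On `s` the average is the constant `μ(s)⁻² I`, with `I` the double integral of `K` over `s × s`;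
integrating it leaves `μ(s)⁻¹ I`. -/
theorem setLIntegral_kernelAverage {n : ℕ} (s : D.PosCell μ n) :
    ∫⁻ x in s.1, ENNReal.ofReal (D.kernelAverage μ n K x x).re ∂μ =
      ENNReal.ofReal
        (inner ℂ (D.cellVector μ n s) (integralOperator K hK (D.cellVector μ n s))).re := by
  have hpos := D.measureReal_pos s
  rw [inner_cellVector_integralOperator]
  set I := ∫ x in s.1, ∫ y in s.1, K (x, y) ∂μ ∂μ
  have hconst : ∀ x ∈ s.1, ENNReal.ofReal (D.kernelAverage μ n K x x).re =
      ENNReal.ofReal ((((μ.real s.1 * μ.real s.1 : ℝ) : ℂ)⁻¹ * I).re) := fun x hx => by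
    rw [kernelAverage, D.cell_eq s.2.1 hx]
  rw [setLIntegral_congr_fun (D.measurableSet_of_mem s.2.1) hconst, setLIntegral_const,
    ← ofReal_measureReal (D.measure_ne_top μ s.2.1), ← ENNReal.ofReal_mul' hpos.le]
  congr 1
  rw [← Complex.ofReal_inv, ← Complex.ofReal_inv, Complex.re_ofReal_mul, Complex.re_ofReal_mul]
  field_simp

theorem tsum_inner_cellVector_le (n : ℕ) :
    ∑' s : D.PosCell μ n, ENNReal.ofReal
        (inner ℂ (D.cellVector μ n s) (integralOperator K hK (D.cellVector μ n s))).re ≤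
      ∫⁻ x, ENNReal.ofReal (D.kernelAverage μ n K x x).re ∂μ := by
  have : Countable (D.PosCell μ n) :=
    ((D.countable_partition n).mono fun s (hs : s ∈ D.partition n ∧ μ s ≠ 0) => hs.1).to_subtype
  simp only [← setLIntegral_kernelAverage]
  rw [← lintegral_iUnion (fun s : D.PosCell μ n => D.measurableSet_of_mem s.2.1)
    fun s t hst => D.disjoint_of_ne s.2.1 t.2.1 fun h => hst (Subtype.ext h)]
  exact setLIntegral_le_lintegral _ _

end PartitionData

/-! ### Positivity of the operator and conclusion -/

theorem IsL2PositiveDefinite.integralOperator_nonneg {X : Type*} [MeasurableSpace X]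
    {μ : Measure X} [SFinite μ] {K : X × X → ℂ} {hK : MemLp K 2 (μ.prod μ)}
    (hpos : IsL2PositiveDefinite K hK) : 0 ≤ integralOperator K hK := by
  rw [ContinuousLinearMap.nonneg_iff_isPositive, ContinuousLinearMap.isPositive_iff_complex]
  intro f
  obtain ⟨r, hr⟩ : ∃ r : ℝ, 0 ≤ r ∧ inner ℂ f (integralOperator K hK f) = r :=
    ⟨_, (Complex.nonneg_iff.1 (hpos f)).1, Complex.eq_re_of_ofReal_le (hpos f)⟩
  -- The criterion has the operator in the other slot of the inner product; the value is real, so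
  -- conjugation is harmless.
  rw [← inner_conj_symm, hr.2, Complex.conj_ofReal]
  exact ⟨rfl, hr.1⟩

/-- The hypothesis is read in `[0, ∞]`: by positive definiteness `Eₙ(K)(x, x)` is a nonnegative
real number for every `x`, and its integral may be `∞` for some `n`. -/
theorem theorem4p4 {X : Type*} [TopologicalSpace X] [T2Space X] [LocallyCompactSpace X]
    [SecondCountableTopology X] [MeasurableSpace X] [BorelSpace X]
    (μ : Measure X) [SigmaFinite μ] [IsLocallyFiniteMeasure μ]
    (D : PartitionData X)
    (K : X × X → ℂ) (hK : MemLp K 2 (μ.prod μ))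
    (hpos : IsL2PositiveDefinite K hK)
    (hlim : limsup (fun n => ∫⁻ x, ENNReal.ofReal (D.kernelAverage μ n K x x).re ∂μ) atTop < ∞) :
    IsTraceClass (integralOperator K hK) := by

  -- A finite `M` strictly above the limsup bounds the integrals for all large `n`; earlier ones may
  -- be infinite.
  obtain ⟨M, hM, hMtop⟩ := exists_between hlim
  refine isTraceClass_of_eventually hpos.integralOperator_nonneg D.orthonormal_cellVector
    D.monotone_closure_span_cellVector D.orthogonal_iSup_closure_span_cellVector hMtop.ne ?_
  filter_upwards [eventually_lt_of_limsup_lt hM] with n hn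
  exact (D.tsum_inner_cellVector_le hK n).trans hn.le
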